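/- Let $n\ge 1$ and let $\mathfrak A=(\alpha_{jk})_{j,k=1}^n$ and $\mathfrak B=(\beta_{jk})_{j,k=1}^n$ be two complex skew-Hermitian $n\times n$ matrices. Assume that $\mathfrak A$ is diagonal and that $\mathfrak B$ is connected, i.e. for every $j,k\in\{1,\dots,n\}$ there exist $l\ge 1$ and $r_1,\dots,r_l\in\{1,\dots,n\}$ such that $\beta_{jr_1}\beta_{r_1r_2}\cdots\beta_{r_{l-1}r_l}\beta_{r_lk}\neq 0$. Assume moreover that $$|\alpha_{jj}-\alpha_{kk}|\neq|\alpha_{ll}-\alpha_{mm}|\quad\text{whenever } j\neq k \text{ and } \{j,k\}\neq\{l,m\},$$ where $l=m$ is allowed (so that for $n\ge 2$ the gaps $|\alpha_{jj}-\alpha_{kk}|$, $j\ne k$, are nonzero, and they are distinct for distinct pairs $\{j,k\}$). Then: 1. the real Lie algebra (with bracket $[X,Y]=XY-YX$) generated by $\mathfrak A$ and $\mathfrak B$ contains $\mathfrak{su}(n)$, the Lie algebra of traceless skew-Hermitian $n\times n$ matrices; 2. for every set $\overline U\subseteq\mathbf R$ with at least two points, the control system $\dot x=u\mathfrak A x+\mathfrak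 B x$ is controllable on the unit sphere $\mathcal S_n$ of $\mathbf C^n$ with piecewise constant controls with values in $\overline U$, i.e. for every $x_0,x_1\in\mathcal S_n$ there exist $k\ge 1$, $t_1,\dots,t_k>0$ and $u_1,\dots,u_k\in\overline U$ such that $$x_1=e^{t_k(u_k\mathfrak A+\mathfrak B)}\cdots e^{t_1(u_1\mathfrak A+\mathfrak B)}x_0.$$ -/

import Mathlib

attribute [local instance 100] LieRing.ofAssociativeRing

namespace BilinearControl

/-- A square matrix `C` is connected if any two indices `j`, `k` (equal ones included) are joined
by a finite sequence `r 1, …, r l`, `l ≥ 1`, with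
`C j (r 1) * C (r 1) (r 2) * ⋯ * C (r l) k ≠ 0`; here `r 0 = j` and `r (l + 1) = k`. -/
def IsConnected {n : ℕ} (C : Matrix (Fin n) (Fin n) ℂ) : Prop :=
  ∀ j k : Fin n, ∃ (l : ℕ) (r : ℕ → Fin n), 1 ≤ l ∧ r 0 = j ∧ r (l + 1) = k ∧
    ∏ i ∈ Finset.range (l + 1), C (r i) (r (i + 1)) ≠ 0

/-- The real Lie algebra `su(n)` of traceless skew-Hermitian complex `n × n` matrices, with the
commutator as bracket. -/
def su (n : ℕ) : LieSubalgebra ℝ (Matrix (Fin n) (Fin n) ℂ) where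
  carrier := {X | X.conjTranspose = -X ∧ X.trace = 0}
  add_mem' := by
    rintro X Y ⟨hX, hX'⟩ ⟨hY, hY'⟩
    refine ⟨?_, ?_⟩
    · rw [Matrix.conjTranspose_add, hX, hY, neg_add]
    · rw [Matrix.trace_add, hX', hY', add_zero]
  zero_mem' := by
    refine ⟨?_, ?_⟩ <;> simp
  smul_mem' := by
    rintro c X ⟨hX, hX'⟩
    refine ⟨?_, ?_⟩
    · rw [Matrix.conjTranspose_smul, hX, star_trivial, smul_neg]
    · rw [Matrix.trace_smul, hX', smul_zero]
  lie_mem' := by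
    rintro X Y ⟨hX, hX'⟩ ⟨hY, hY'⟩
    refine ⟨?_, ?_⟩
    · rw [Ring.lie_def, Matrix.conjTranspose_sub, Matrix.conjTranspose_mul,
        Matrix.conjTranspose_mul, hX, hY]
      simp
    · rw [Ring.lie_def, Matrix.trace_sub, Matrix.trace_mul_comm, sub_self]

/-- The final point of the solution of `ẋ = u A x + B x` with initial point `x` for the piecewise
constant control described by a list `[(t₁, u₁), …, (t_k, u_k)]` of durations and values (the
control is equal to `u₁` during time `t₁`, then to `u₂` during time `t₂`, and so on), that is,
`exp (t_k (u_k A + B)) ⋯ exp (t₁ (u₁ A + B)) x`. -/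
noncomputable def endpoint {n : ℕ} (A B : Matrix (Fin n) (Fin n) ℂ) (c : List (ℝ × ℝ))
    (x : EuclideanSpace ℂ (Fin n)) : EuclideanSpace ℂ (Fin n) :=
  c.foldl (fun y p => Matrix.toEuclideanLin (NormedSpace.exp (p.1 • (p.2 • A + B))) y) x

/-- The system `ẋ = u A x + B x` is (exactly) controllable on the unit sphere of `ℂⁿ` with
piecewise constant controls with values in `U`. -/
def IsControllable {n : ℕ} (A B : Matrix (Fin n) (Fin n) ℂ) (U : Set ℝ) : Prop :=
  ∀ x₀ ∈ Metric.sphere (0 : EuclideanSpace ℂ (Fin n)) 1,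
    ∀ x₁ ∈ Metric.sphere (0 : EuclideanSpace ℂ (Fin n)) 1,
      ∃ c : List (ℝ × ℝ), c ≠ [] ∧ (∀ p ∈ c, 0 < p.1 ∧ p.2 ∈ U) ∧ x₁ = endpoint A B c x₀

end BilinearControl

/-!
Write `L` for the real Lie algebra generated by `A` and `B`.

*`L` contains `su n`.* As `A` is diagonal, `(ad A)²` multiplies the `(j, k)` entry of a matrix by
`-|a_j - a_k|²`. By the condition on the gaps a polynomial in `(ad A)²` kills every entry of `B`
except those at `(j, k)` and `(k, j)` (`skewUnit_apply_mem`); one more bracket with `A` gives all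
the matrices `z E_jk - z̄ E_kj` with `B j k ≠ 0`. Brackets along paths of nonzero entries of `B` give
the remaining pairs (`skewUnit_mem`), and these matrices generate `su n` (`su_le`). Consequently `L`
maps a unit vector onto the tangent space of the sphere (`exists_mulVec_eq`). Two values of the
control suffice to recover `A` and `B` as linear combinations of the matrices `u A + B`.

*Controllability.* Let `S` be the semigroup of unitary matrices generated by the flows of the
matrices `u A + B` in positive time. The unitary group is compact, so the closure `K` of `S` is a
group (`coe_flowGroup`). For a product of flows with derivative image `Q W` at the point `Q`,
prolonging the motion adds the direction `Q⁻¹ X Q` to `W`. If `W` is maximal, it therefore contains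
`k⁻¹ X k` for all `k` in `K`, and so contains the Lie algebra generated by the `X`
(`lieSpan_le_of_conj`, `exists_attainsDirections_lieSpan`). The inverse function theorem then shows
that `S x` contains an open piece of the sphere (`exists_attainable_mem_nhdsWithin`). Hence the
orbits of `K` are open in the sphere; they are also compact, and the sphere is connected, so `K` is
transitive (`exists_flowGroup_evalAt_eq`). Finally some `k` in `K` moves `y` into an open piece of
`S x`, and approximating `k⁻¹` by an element `s` of `S` gives `s⁻¹ y ∈ S x`, that is, `y ∈ S x`
(`exists_attainable_evalAt_eq`).
-/

namespace BilinearControl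

open Matrix Polynomial Topology Filter

/-! ### The Lie algebra generated by `A` and `B` -/

/-- The skew-Hermitian matrix `z E_jk - z̄ E_kj`. For `j = k` it is `2 i (Im z) E_jj`. -/
noncomputable def skewUnit {n : ℕ} (j k : Fin n) (z : ℂ) : Matrix (Fin n) (Fin n) ℂ :=
  single j k z - single k j (star z)

variable {n : ℕ}

lemma smul_skewUnit (c : ℝ) (j k : Fin n) (z : ℂ) :
    c • skewUnit j k z = skewUnit j k (c * z) := by
  simp [skewUnit, smul_sub, smul_single]

lemma skewUnit_add (j k : Fin n) (z w : ℂ) :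
    skewUnit j k (z + w) = skewUnit j k z + skewUnit j k w := by
  simp only [skewUnit, star_add, single_add]
  abel

lemma lie_skewUnit {j k l : Fin n} (hjk : j ≠ k) (hkl : k ≠ l) (hjl : j ≠ l) (z w : ℂ) :
    ⁅skewUnit j k z, skewUnit k l w⁆ = skewUnit j l (z * w) := by
  simp [skewUnit, Ring.lie_def, sub_mul, mul_sub, hjk, hkl, hjl, hjk.symm, hkl.symm, hjl.symm,
    mul_comm]

lemma lie_skewUnit_self {j k : Fin n} (hjk : j ≠ k) :
    ⁅skewUnit j k 1, skewUnit j k Complex.I⁆ =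
      skewUnit j j Complex.I - skewUnit k k Complex.I := by
  simp [skewUnit, Ring.lie_def, sub_mul, mul_sub, hjk, hjk.symm]
  abel

/-- On matrices, `(ad A)²` for a diagonal skew-Hermitian `A` multiplies the `(j, k)` entry by the
real number `-|a_j - a_k|²`. -/
lemma lie_lie_apply {A : Matrix (Fin n) (Fin n) ℂ} (hA : A.conjTranspose = -A)
    (hAdiag : A.IsDiag) (Y : Matrix (Fin n) (Fin n) ℂ) (j k : Fin n) :
    ⁅A, ⁅A, Y⁆⁆ j k = ((-‖A j j - A k k‖ ^ 2 : ℝ) : ℂ) * Y j k := by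
  obtain ⟨a, rfl⟩ : ∃ a, A = diagonal a := ⟨_, hAdiag.diagonal_diag.symm⟩
  have hs : ∀ i, star (a i) = -a i := fun i => by
    have := congrFun₂ hA i i
    simpa using this
  have h : ((‖a j - a k‖ ^ 2 : ℝ) : ℂ) = -(a j - a k) ^ 2 := by
    rw [Complex.ofReal_pow, ← Complex.mul_conj', starRingEnd_apply, star_sub, hs, hs]
    ring
  simp only [diagonal_apply_eq, Complex.ofReal_neg, h]
  simp only [Ring.lie_def, Matrix.sub_apply, diagonal_mul, mul_diagonal, mul_sub, sub_mul]
  ring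

lemma aeval_ad_sq_apply {A : Matrix (Fin n) (Fin n) ℂ} (hA : A.conjTranspose = -A)
    (hAdiag : A.IsDiag) (p : ℝ[X]) (Y : Matrix (Fin n) (Fin n) ℂ) (j k : Fin n) :
    aeval (LieAlgebra.ad ℝ (Matrix (Fin n) (Fin n) ℂ) A ^ 2) p Y j k =
      ((p.eval (-‖A j j - A k k‖ ^ 2) : ℝ) : ℂ) * Y j k := by
  induction p using Polynomial.induction_on generalizing Y with
  | C c => simp [Module.algebraMap_end_apply, Matrix.smul_apply]
  | add p q hp hq => simp [LinearMap.add_apply, Matrix.add_apply, hp, hq, add_mul]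
  | monomial m c ih =>
    have hs : (C c * X ^ (m + 1) : ℝ[X]) = C c * X ^ m * X := by ring
    rw [hs, map_mul, aeval_X, Module.End.mul_apply, ih,
      pow_two (LieAlgebra.ad ℝ _ A), Module.End.mul_apply, LieAlgebra.ad_apply, LieAlgebra.ad_apply,
      lie_lie_apply hA hAdiag]
    simp only [eval_mul, eval_X]
    push_cast
    ring

lemma aeval_ad_sq_mem {L : LieSubalgebra ℝ (Matrix (Fin n) (Fin n) ℂ)}
    {A : Matrix (Fin n) (Fin n) ℂ} (hAL : A ∈ L) (p : ℝ[X]) {Y : Matrix (Fin n) (Fin n) ℂ}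
    (hY : Y ∈ L) : aeval (LieAlgebra.ad ℝ (Matrix (Fin n) (Fin n) ℂ) A ^ 2) p Y ∈ L := by
  induction p using Polynomial.induction_on generalizing Y with
  | C c => simpa [Module.algebraMap_end_apply] using L.smul_mem c hY
  | add p q hp hq => simpa [LinearMap.add_apply] using L.add_mem (hp hY) (hq hY)
  | monomial m c ih =>
    have hs : (C c * X ^ (m + 1) : ℝ[X]) = C c * X ^ m * X := by ring
    rw [hs, map_mul, aeval_X, Module.End.mul_apply, pow_two, Module.End.mul_apply]
    exact ih (L.lie_mem hAL (L.lie_mem hAL hY))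

/-- Since all the gaps differ, a polynomial in `(ad A)²` isolates the `(j, k)` and `(k, j)` entries
of `B`. -/
lemma skewUnit_apply_mem {A B : Matrix (Fin n) (Fin n) ℂ} (hA : A.conjTranspose = -A)
    (hB : B.conjTranspose = -B) (hAdiag : A.IsDiag)
    (hgap : ∀ j k l m : Fin n, j ≠ k → s(j, k) ≠ s(l, m) →
      ‖A j j - A k k‖ ≠ ‖A l l - A m m‖)
    {L : LieSubalgebra ℝ (Matrix (Fin n) (Fin n) ℂ)} (hAL : A ∈ L) (hBL : B ∈ L)
    {j k : Fin n} (hjk : j ≠ k) : skewUnit j k (B j k) ∈ L := by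
  -- the roots of `p` are the eigenvalues of `(ad A)²` at all the other pairs
  let p : ℝ[X] := ∏ q : Fin n × Fin n with s(j, k) ≠ s(q.1, q.2),
    (X - C (-‖A q.1 q.1 - A q.2 q.2‖ ^ 2))
  have hp : ∀ l m, s(j, k) ≠ s(l, m) → p.eval (-‖A l l - A m m‖ ^ 2) = 0 := by
    intro l m h
    rw [eval_prod]
    exact Finset.prod_eq_zero (i := (l, m)) (by simpa using h) (by simp)
  have hp0 : p.eval (-‖A j j - A k k‖ ^ 2) ≠ 0 := by
    rw [eval_prod, Finset.prod_ne_zero_iff]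
    rintro ⟨l, m⟩ h
    have h' := hgap j k l m hjk (by simpa using h)
    simp only [eval_sub, eval_X, eval_C]
    intro h0
    apply h'
    have : ‖A j j - A k k‖ ^ 2 = ‖A l l - A m m‖ ^ 2 := by linarith
    exact (sq_eq_sq₀ (norm_nonneg _) (norm_nonneg _)).1 this
  have key : skewUnit j k (B j k) = (p.eval (-‖A j j - A k k‖ ^ 2))⁻¹ •
      aeval (LieAlgebra.ad ℝ (Matrix (Fin n) (Fin n) ℂ) A ^ 2) p B := by
    ext l m
    have hBs : ∀ a b, star (B a b) = -B b a := fun a b => by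
      simpa using congrFun₂ hB b a
    rw [Matrix.smul_apply, aeval_ad_sq_apply hA hAdiag, Complex.real_smul, ← mul_assoc]
    by_cases h : s(j, k) = s(l, m)
    · rcases Sym2.eq_iff.1 h with ⟨rfl, rfl⟩ | ⟨rfl, rfl⟩
      · rw [← Complex.ofReal_mul, inv_mul_cancel₀ hp0]
        simp [skewUnit, hjk, hjk.symm]
      · rw [norm_sub_rev (A k k), ← Complex.ofReal_mul, inv_mul_cancel₀ hp0]
        simp [skewUnit, hjk, hjk.symm, -RCLike.star_def, hBs]
    · rw [hp l m h]
      have h1 : ¬ (j = l ∧ k = m) := fun e => h (Sym2.eq_iff.2 (Or.inl e))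
      have h2 : ¬ (k = l ∧ j = m) := fun e => h (Sym2.eq_iff.2 (Or.inr e.symm))
      simp [skewUnit, h1, h2]
  rw [key]
  exact L.smul_mem _ (aeval_ad_sq_mem hAL p hBL)

/-- Bracketing with a diagonal `A` rotates a nonzero off-diagonal coefficient by a right angle, so
one nonzero coefficient yields all of them. -/
lemma skewUnit_mem_of_ne_zero {A : Matrix (Fin n) (Fin n) ℂ} (hA : A.conjTranspose = -A)
    (hAdiag : A.IsDiag) {L : LieSubalgebra ℝ (Matrix (Fin n) (Fin n) ℂ)} (hAL : A ∈ L)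
    {j k : Fin n} (hjk : A j j ≠ A k k) {b : ℂ} (hb : b ≠ 0) (hbL : skewUnit j k b ∈ L) (z : ℂ) :
    skewUnit j k z ∈ L := by
  obtain ⟨a, rfl⟩ : ∃ a, A = diagonal a := ⟨_, hAdiag.diagonal_diag.symm⟩
  have hs : ∀ i, star (a i) = -a i := fun i => by
    simpa using congrFun₂ hA i i
  simp only [diagonal_apply_eq] at hjk
  have hlie : ⁅diagonal a, skewUnit j k b⁆ = skewUnit j k ((a j - a k) * b) := by
    ext l m
    simp only [skewUnit, Ring.lie_def, Matrix.sub_apply, diagonal_mul, mul_diagonal, single_apply,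
      star_mul', star_sub, hs]
    grind
  have hre : ∀ i, (a i).re = 0 := fun i => by
    have := congrArg Complex.re (hs i)
    simp at this
    linarith
  have him : (a j - a k).im ≠ 0 := fun h0 =>
    hjk (sub_eq_zero.1 (Complex.ext (by simp [hre]) (by simpa using h0)))
  have hI : a j - a k = ((a j - a k).im : ℂ) * Complex.I := by
    apply Complex.ext <;> simp [hre]
  have h1 : skewUnit j k (Complex.I * b) ∈ L := by
    have := L.smul_mem (a j - a k).im⁻¹ (L.lie_mem hAL hbL)
    rw [hlie, smul_skewUnit, hI] at this
    convert this using 2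
    have : ((a j - a k).im : ℂ) ≠ 0 := by exact_mod_cast him
    push_cast
    simp only [Complex.mul_I_im, Complex.ofReal_re]
    field_simp
  have hz : z = ((z / b).re : ℂ) * b + ((z / b).im : ℂ) * (Complex.I * b) := by
    rw [← mul_assoc, ← add_mul, Complex.re_add_im, div_mul_cancel₀ _ hb]
  rw [hz, skewUnit_add, ← smul_skewUnit, ← smul_skewUnit]
  exact L.add_mem (L.smul_mem _ hbL) (L.smul_mem _ h1)

/-- A walk in the graph of nonzero entries of `B` gives all the off-diagonal skew-Hermitian units,
by composing brackets along the walk. -/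
lemma skewUnit_mem {A B : Matrix (Fin n) (Fin n) ℂ} (hA : A.conjTranspose = -A)
    (hB : B.conjTranspose = -B) (hAdiag : A.IsDiag) (hBconn : IsConnected B)
    (hgap : ∀ j k l m : Fin n, j ≠ k → s(j, k) ≠ s(l, m) →
      ‖A j j - A k k‖ ≠ ‖A l l - A m m‖)
    {L : LieSubalgebra ℝ (Matrix (Fin n) (Fin n) ℂ)} (hAL : A ∈ L) (hBL : B ∈ L)
    {j k : Fin n} (hjk : j ≠ k) (z : ℂ) : skewUnit j k z ∈ L := by
  have hstep : ∀ a b, a ≠ b → B a b ≠ 0 → ∀ z, skewUnit a b z ∈ L := fun a b hab h0 z =>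
    skewUnit_mem_of_ne_zero hA hAdiag hAL
      (fun h => hgap a b a a hab (by simp [hab.symm]) (by simp [h])) h0
      (skewUnit_apply_mem hA hB hAdiag hgap hAL hBL hab) z
  obtain ⟨l, r, -, rfl, rfl, hr⟩ := hBconn j k
  rw [Finset.prod_ne_zero_iff] at hr
  have : ∀ m ≤ l + 1, r 0 ≠ r m → ∀ z, skewUnit (r 0) (r m) z ∈ L := by
    intro m
    induction m with
    | zero => intro _ h; exact absurd rfl h
    | succ m ih =>
      intro hm hne z
      have hB' := hr m (by simpa using hm)
      by_cases h1 : r 0 = r m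
      · rw [h1] at hne ⊢
        exact hstep _ _ hne hB' z
      by_cases h2 : r m = r (m + 1)
      · rw [← h2] at hne ⊢
        exact ih (by omega) hne z
      · have := L.lie_mem (ih (by omega) h1 z) (hstep _ _ h2 hB' 1)
        rwa [lie_skewUnit h1 h2 hne, mul_one] at this
  exact this _ le_rfl hjk z

/-- A traceless skew-Hermitian `X` is half the sum of the units with coefficients `X j k`. The
diagonal units are not in `su n` themselves, but vanishing trace allows multiples of a fixed one to
be subtracted from them, and a difference of two diagonal units is the bracket of two off-diagonal
ones. -/
theorem su_le {A B : Matrix (Fin n) (Fin n) ℂ} (hA : A.conjTranspose = -A)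
    (hB : B.conjTranspose = -B) (hAdiag : A.IsDiag) (hBconn : IsConnected B)
    (hgap : ∀ j k l m : Fin n, j ≠ k → s(j, k) ≠ s(l, m) →
      ‖A j j - A k k‖ ≠ ‖A l l - A m m‖)
    {L : LieSubalgebra ℝ (Matrix (Fin n) (Fin n) ℂ)} (hAL : A ∈ L) (hBL : B ∈ L) :
    su n ≤ L := by
  rintro X ⟨hX, htr⟩
  have hoff : ∀ j k, j ≠ k → ∀ z, skewUnit j k z ∈ L := fun j k h z =>
    skewUnit_mem hA hB hAdiag hBconn hgap hAL hBL h z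
  have hdiag : ∀ j k, skewUnit j j Complex.I - skewUnit k k Complex.I ∈ L := fun j k => by
    by_cases h : j = k
    · simp [h]
    · rw [← lie_skewUnit_self h]
      exact L.lie_mem (hoff _ _ h _) (hoff _ _ h _)
  have hs : ∀ a b, star (X a b) = -X b a := fun a b => by
    simpa using congrFun₂ hX b a
  have hXjj : ∀ j, X j j = ((X j j).im : ℂ) * Complex.I := fun j => by
    have := congrArg Complex.re (hs j j)
    simp at this
    apply Complex.ext
    · simp; linarith
    · simp
  have hsplit : X = (1 / 2 : ℝ) • ∑ j, ∑ k, skewUnit j k (X j k) := by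
    have h1 : ∀ j k, skewUnit j k (X j k) = single j k (X j k) + single k j (X k j) := by
      intro j k
      rw [skewUnit, hs, ← single_neg, sub_neg_eq_add]
    simp only [h1, Finset.sum_add_distrib]
    rw [Finset.sum_comm (f := fun j k => single k j (X k j)), ← matrix_eq_sum_single, ← two_smul ℝ,
      smul_smul]
    norm_num
  rcases isEmpty_or_nonempty (Fin n) with hn | ⟨⟨i⟩⟩
  · rw [Subsingleton.elim X 0]; exact L.zero_mem
  have him : ∑ j, (X j j).im = 0 := by
    simpa [trace] using congrArg Complex.im htr
  have hterm : ∀ j k, skewUnit j k (X j k) -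
      (if j = k then (X j j).im else 0) • skewUnit i i Complex.I ∈ L := by
    intro j k
    split_ifs with h
    · subst h
      have := L.smul_mem (X j j).im (hdiag j i)
      rwa [smul_sub, smul_skewUnit _ j j, ← hXjj] at this
    · simpa using hoff j k h _
  have hzero : ∑ j, ∑ k, (if j = k then (X j j).im else 0) • skewUnit i i Complex.I = 0 := by
    simp only [← Finset.sum_smul]
    simp [him]
  rw [hsplit]
  refine L.smul_mem _ ?_
  rw [← sub_zero (∑ j, ∑ k, skewUnit j k (X j k)), ← hzero]
  simp only [← Finset.sum_sub_distrib]
  exact sum_mem fun j _ => sum_mem fun k _ => hterm j k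

/-- A Lie algebra that contains `A` and `B` acts on a unit vector `x` with all of the tangent space
of the sphere in its image. For `n ≠ 1` the matrix is taken in `su n`; for `n = 1` it is a multiple
of `B`, which connectedness makes nonzero. -/
lemma exists_mulVec_eq {A B : Matrix (Fin n) (Fin n) ℂ} (hA : A.conjTranspose = -A)
    (hB : B.conjTranspose = -B) (hAdiag : A.IsDiag) (hBconn : IsConnected B)
    (hgap : ∀ j k l m : Fin n, j ≠ k → s(j, k) ≠ s(l, m) →
      ‖A j j - A k k‖ ≠ ‖A l l - A m m‖)
    {L : LieSubalgebra ℝ (Matrix (Fin n) (Fin n) ℂ)} (hAL : A ∈ L) (hBL : B ∈ L)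
    {x v : Fin n → ℂ} (hx : star x ⬝ᵥ x = 1) (hv : (star x ⬝ᵥ v).re = 0) :
    ∃ Y ∈ L, Y *ᵥ x = v := by
  set c := star x ⬝ᵥ v with hc
  have hcc : star c = -c := by apply Complex.ext <;> simp [hv]
  have hvx : star v ⬝ᵥ x = -c := by rw [← hcc, hc, star_dotProduct]
  by_cases hn : n = 1
  · subst hn
    obtain ⟨l, r, -, -, -, hr⟩ := hBconn 0 0
    have hB0 : B 0 0 ≠ 0 := by
      rw [Finset.prod_ne_zero_iff] at hr
      simpa [Subsingleton.elim _ (0 : Fin 1)] using hr 0 (by simp)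
    have hBs : star (B 0 0) = -B 0 0 := by simpa using congrFun₂ hB 0 0
    have hreal : (((c / B 0 0).re : ℝ) : ℂ) = c / B 0 0 := by
      rw [← Complex.conj_eq_iff_re, starRingEnd_apply, star_div₀, hcc, hBs, neg_div_neg_eq]
    refine ⟨(c / B 0 0).re • B, L.smul_mem _ hBL, funext fun i => ?_⟩
    obtain rfl : i = 0 := Subsingleton.elim _ _
    have hx' : star (x 0) * x 0 = 1 := by simpa [dotProduct] using hx
    have hc' : c = star (x 0) * v 0 := by simp [hc, dotProduct]
    have h1 : (((c / B 0 0).re • B) *ᵥ x) 0 = ((c / B 0 0).re : ℂ) * (B 0 0 * x 0) := by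
      simp [mulVec, dotProduct, mul_assoc]
    rw [h1, hreal, ← mul_assoc, div_mul_cancel₀ _ hB0, hc', mul_right_comm, hx', one_mul]
  · have hn1 : ((n : ℂ) - 1) ≠ 0 := by
      rw [sub_ne_zero]; exact_mod_cast hn
    -- the first three terms map `x` to `v`; the last one annihilates `x` and corrects the trace
    let Y := vecMulVec v (star x) - vecMulVec x (star v) - c • vecMulVec x (star x) -
      (c / (n - 1)) • (1 - vecMulVec x (star x))
    refine ⟨Y, su_le hA hB hAdiag hBconn hgap hAL hBL ⟨?_, ?_⟩, ?_⟩
    · have h1 : star (c / ((n : ℂ) - 1)) = - (c / (n - 1)) := by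
        simp only [star_div₀, star_sub, star_natCast, star_one, hcc, neg_div]
      simp only [Y, conjTranspose_sub, conjTranspose_smul, conjTranspose_vecMulVec, star_star, hcc,
        h1, conjTranspose_one, neg_smul]
      abel
    · simp only [Y, trace_sub, trace_smul, trace_vecMulVec, trace_one, Fintype.card_fin,
        dotProduct_comm _ (star _), hx, hvx, ← hc, smul_eq_mul]
      field_simp
      ring
    · simp only [Y, sub_mulVec, smul_mulVec, vecMulVec_mulVec, one_mulVec, hx, hvx]
      simp

/-! ### Unitary matrices and their action on vectors -/

instance compactSpace_unitaryGroup : CompactSpace (unitaryGroup (Fin n) ℂ) := by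
  refine isCompact_iff_compactSpace.1
    (?_ : IsCompact (unitaryGroup (Fin n) ℂ : Set (Matrix (Fin n) (Fin n) ℂ)))
  refine IsCompact.of_isClosed_subset
    (isCompact_univ_pi fun _ => isCompact_univ_pi fun _ => isCompact_closedBall (0 : ℂ) 1)
    (isClosed_unitary (R := Matrix (Fin n) (Fin n) ℂ)) ?_
  intro g hg i _ j _
  simpa using entry_norm_bound_of_unitary hg i j

lemma norm_toEuclideanLin_unitary (g : unitaryGroup (Fin n) ℂ) (x : EuclideanSpace ℂ (Fin n)) :
    ‖toEuclideanLin (g : Matrix (Fin n) (Fin n) ℂ) x‖ = ‖x‖ := by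
  have hg : (star (g : Matrix (Fin n) (Fin n) ℂ)) * g = 1 := mem_unitaryGroup_iff'.1 g.2
  have h : inner ℂ (toEuclideanLin (g : Matrix (Fin n) (Fin n) ℂ) x)
      (toEuclideanLin (g : Matrix (Fin n) (Fin n) ℂ) x) = inner ℂ x x := by
    rw [EuclideanSpace.inner_eq_star_dotProduct, EuclideanSpace.inner_eq_star_dotProduct,
      ofLp_toLpLin, toLin'_apply, star_mulVec, dotProduct_comm, ← dotProduct_mulVec,
      mulVec_mulVec, ← star_eq_conjTranspose, hg, one_mulVec, dotProduct_comm]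
  rw [inner_self_eq_norm_sq_to_K, inner_self_eq_norm_sq_to_K] at h
  exact (sq_eq_sq₀ (norm_nonneg _) (norm_nonneg _)).1 (by exact_mod_cast h)

/-- Evaluation of matrices at a vector of the Euclidean space, as a continuous linear map. -/
noncomputable def evalAt (x : EuclideanSpace ℂ (Fin n)) :
    Matrix (Fin n) (Fin n) ℂ →L[ℝ] EuclideanSpace ℂ (Fin n) :=
  LinearMap.toContinuousLinearMap
    { toFun := fun M => toEuclideanLin M x
      map_add' := fun M N => by simp
      map_smul' := fun c M => by
        ext i; simp [toLpLin_apply, smul_mulVec] }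

@[simp] lemma evalAt_apply (x : EuclideanSpace ℂ (Fin n)) (M : Matrix (Fin n) (Fin n) ℂ) :
    evalAt x M = toEuclideanLin M x := rfl

lemma evalAt_mul (x : EuclideanSpace ℂ (Fin n)) (M N : Matrix (Fin n) (Fin n) ℂ) :
    evalAt x (M * N) = evalAt (evalAt x N) M := by
  simp

lemma evalAt_one (x : EuclideanSpace ℂ (Fin n)) : evalAt x 1 = x := by simp

lemma evalAt_vec_smul (r : ℝ) (x : EuclideanSpace ℂ (Fin n)) (M : Matrix (Fin n) (Fin n) ℂ) :
    evalAt (r • x) M = r • evalAt x M := by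
  ext i; simp [toLpLin_apply]

lemma evalAt_vec_add (x y : EuclideanSpace ℂ (Fin n)) (M : Matrix (Fin n) (Fin n) ℂ) :
    evalAt (x + y) M = evalAt x M + evalAt y M := by
  ext i; simp [toLpLin_apply, mulVec_add]

lemma norm_evalAt (g : unitaryGroup (Fin n) ℂ) (x : EuclideanSpace ℂ (Fin n)) :
    ‖evalAt x (g : Matrix (Fin n) (Fin n) ℂ)‖ = ‖x‖ := norm_toEuclideanLin_unitary g x

/-! ### Attainable matrices and the flow group -/

/-- The unitary matrices `exp (t X)` with `t > 0` and `X ∈ 𝒳`. -/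
def flows (𝒳 : Set (Matrix (Fin n) (Fin n) ℂ)) : Set (unitaryGroup (Fin n) ℂ) :=
  {g | ∃ t : ℝ, 0 < t ∧ ∃ X ∈ 𝒳, (g : Matrix (Fin n) (Fin n) ℂ) = NormedSpace.exp (t • X)}

/-- The matrices attained from the identity by switching between the vector fields of `𝒳`. -/
noncomputable def attainable (𝒳 : Set (Matrix (Fin n) (Fin n) ℂ)) :
    Submonoid (unitaryGroup (Fin n) ℂ) :=
  Submonoid.closure (flows 𝒳)

/-- The closed subgroup generated by the flows of `𝒳`. -/
noncomputable def flowGroup (𝒳 : Set (Matrix (Fin n) (Fin n) ℂ)) :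
    Subgroup (unitaryGroup (Fin n) ℂ) :=
  (Subgroup.closure (flows 𝒳)).topologicalClosure

/-- In a compact group, the closure of a subsemigroup is a group: no inverse flows are needed. -/
lemma coe_flowGroup (𝒳 : Set (Matrix (Fin n) (Fin n) ℂ)) :
    (flowGroup 𝒳 : Set (unitaryGroup (Fin n) ℂ)) = closure (attainable 𝒳) := by
  rw [flowGroup, Subgroup.topologicalClosure_coe, attainable,
    closure_submonoidClosure_eq_closure_subgroupClosure]

lemma attainable_le_flowGroup {𝒳 : Set (Matrix (Fin n) (Fin n) ℂ)} {g : unitaryGroup (Fin n) ℂ}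
    (hg : g ∈ attainable 𝒳) : g ∈ flowGroup 𝒳 := by
  rw [← SetLike.mem_coe, coe_flowGroup]
  exact subset_closure hg

lemma exp_mem_unitaryGroup {X : Matrix (Fin n) (Fin n) ℂ} (hX : X.conjTranspose = -X) :
    NormedSpace.exp X ∈ unitaryGroup (Fin n) ℂ := by
  rw [mem_unitaryGroup_iff, star_eq_conjTranspose, ← Matrix.exp_conjTranspose, hX,
    ← Matrix.exp_add_of_commute _ _ (Commute.refl X).neg_right, add_neg_cancel,
    NormedSpace.exp_zero]

/-- The flow of a skew-Hermitian matrix, as a unitary matrix. -/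
noncomputable def flow {X : Matrix (Fin n) (Fin n) ℂ} (hX : X.conjTranspose = -X) (t : ℝ) :
    unitaryGroup (Fin n) ℂ :=
  ⟨NormedSpace.exp (t • X), exp_mem_unitaryGroup (by
    rw [conjTranspose_smul, hX, star_trivial, smul_neg])⟩

lemma coe_flow {X : Matrix (Fin n) (Fin n) ℂ} (hX : X.conjTranspose = -X) (t : ℝ) :
    (flow hX t : Matrix (Fin n) (Fin n) ℂ) = NormedSpace.exp (t • X) := rfl

lemma coe_flow_inv {X : Matrix (Fin n) (Fin n) ℂ} (hX : X.conjTranspose = -X) (t : ℝ) :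
    (((flow hX t)⁻¹ : unitaryGroup (Fin n) ℂ) : Matrix (Fin n) (Fin n) ℂ) =
      NormedSpace.exp (t • -X) := by
  change star (NormedSpace.exp (t • X)) = _
  rw [star_eq_conjTranspose, ← Matrix.exp_conjTranspose, conjTranspose_smul, hX, star_trivial]

lemma flow_mem {𝒳 : Set (Matrix (Fin n) (Fin n) ℂ)} {X : Matrix (Fin n) (Fin n) ℂ} (hX𝒳 : X ∈ 𝒳)
    (hX : X.conjTranspose = -X) {t : ℝ} (ht : 0 < t) : flow hX t ∈ attainable 𝒳 :=
  Submonoid.subset_closure ⟨t, ht, X, hX𝒳, rfl⟩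

lemma coe_mul_coe_inv (g : unitaryGroup (Fin n) ℂ) :
    (g : Matrix (Fin n) (Fin n) ℂ) * ((g⁻¹ : unitaryGroup (Fin n) ℂ) : Matrix (Fin n) (Fin n) ℂ)
      = 1 := congrArg Subtype.val (mul_inv_cancel g)

open scoped Matrix.Norms.Operator

/-- A subspace that contains all the conjugates of the elements of `𝒳` by the flow group contains
the Lie algebra generated by `𝒳`. -/
lemma lieSpan_le_of_conj {𝒳 : Set (Matrix (Fin n) (Fin n) ℂ)}
    (h𝒳 : ∀ X ∈ 𝒳, X.conjTranspose = -X) {W : Submodule ℝ (Matrix (Fin n) (Fin n) ℂ)}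
    (hW : ∀ k ∈ flowGroup 𝒳, ∀ X ∈ 𝒳,
      ((k⁻¹ : unitaryGroup (Fin n) ℂ) : Matrix (Fin n) (Fin n) ℂ) * X * k ∈ W)
    {Y : Matrix (Fin n) (Fin n) ℂ} (hY : Y ∈ LieSubalgebra.lieSpan ℝ _ 𝒳) : Y ∈ W := by
  -- the largest subspace of `W` that is stable under conjugation by the flow group
  let V : Submodule ℝ (Matrix (Fin n) (Fin n) ℂ) :=
    { carrier := {Z | ∀ k ∈ flowGroup 𝒳,
        ((k⁻¹ : unitaryGroup (Fin n) ℂ) : Matrix (Fin n) (Fin n) ℂ) * Z * k ∈ W}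
      add_mem' := fun {a b} ha hb k hk => by
        rw [mul_add, add_mul]; exact W.add_mem (ha k hk) (hb k hk)
      zero_mem' := fun k _ => by simp
      smul_mem' := fun c a ha k hk => by
        rw [mul_smul_comm, smul_mul_assoc]; exact W.smul_mem c (ha k hk) }
  have hVconj : ∀ Z ∈ V, ∀ k ∈ flowGroup 𝒳,
      ((k⁻¹ : unitaryGroup (Fin n) ℂ) : Matrix (Fin n) (Fin n) ℂ) * Z * k ∈ V := by
    intro Z hZ k hk l hl
    have := hZ (k * l) (mul_mem hk hl)
    rw [_root_.mul_inv_rev] at this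
    simpa only [Submonoid.coe_mul, mul_assoc] using this
  have hlie : ∀ X ∈ 𝒳, ∀ Z ∈ V, ⁅X, Z⁆ ∈ V := by
    intro X hX Z hZ
    -- differentiate the conjugates of `Z` along the flow of `X` at time zero
    have h1 := hasDerivAt_exp_smul_const (-X) (0 : ℝ)
    have h2 := hasDerivAt_exp_smul_const X (0 : ℝ)
    have h3 := (h1.mul_const Z).mul h2
    simp only [zero_smul, NormedSpace.exp_zero, one_mul, mul_one] at h3
    have h4 := (hasDerivAt_iff_tendsto_slope.1 h3).mono_left
      (nhdsWithin_mono 0 (fun t (ht : 0 < t) => ht.ne') : 𝓝[>] (0 : ℝ) ≤ 𝓝[≠] 0)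
    have h5 : -X * Z + Z * X ∈ (V : Set (Matrix (Fin n) (Fin n) ℂ)) := by
      refine (V.closed_of_finiteDimensional).mem_of_tendsto h4 ?_
      filter_upwards [self_mem_nhdsWithin] with t (ht : 0 < t)
      rw [slope_def_module]
      refine V.smul_mem _ (V.sub_mem ?_ (by simpa using hZ))
      have := hVconj Z hZ _ (attainable_le_flowGroup (flow_mem hX (h𝒳 X hX) ht))
      rwa [coe_flow_inv, coe_flow] at this
    have h6 := V.neg_mem h5
    rwa [Ring.lie_def, show X * Z - Z * X = -(-X * Z + Z * X) by noncomm_ring]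
  have hXV : ∀ X ∈ 𝒳, X ∈ V := fun X hX k hk => hW k hk X hX
  -- inside its own normalizer `V` is a Lie subalgebra
  let N : LieSubalgebra ℝ (Matrix (Fin n) (Fin n) ℂ) :=
    { carrier := {Y | Y ∈ V ∧ ∀ Z ∈ V, ⁅Y, Z⁆ ∈ V}
      add_mem' := fun {a b} ha hb => ⟨V.add_mem ha.1 hb.1, fun Z hZ => by
        rw [add_lie]; exact V.add_mem (ha.2 Z hZ) (hb.2 Z hZ)⟩
      zero_mem' := ⟨V.zero_mem, fun Z _ => by rw [zero_lie]; exact V.zero_mem⟩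
      smul_mem' := fun c a ha => ⟨V.smul_mem c ha.1, fun Z hZ => by
        rw [smul_lie]; exact V.smul_mem c (ha.2 Z hZ)⟩
      lie_mem' := fun {a b} ha hb => ⟨ha.2 b hb.1, fun Z hZ => by
        rw [lie_lie]; exact V.sub_mem (ha.2 _ (hb.2 Z hZ)) (hb.2 _ (ha.2 Z hZ))⟩ }
  have hN : LieSubalgebra.lieSpan ℝ _ 𝒳 ≤ N :=
    LieSubalgebra.lieSpan_le.2 fun X hX => ⟨hXV X hX, hlie X hX⟩
  simpa using (hN hY).1 1 (one_mem _)

/-! ### Attained directions -/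

section

variable {𝔸 E : Type*} [NormedRing 𝔸] [NormedAlgebra ℝ 𝔸]
  [NormedAddCommGroup E] [NormedSpace ℝ E]

lemma hasStrictFDerivAt_mul_left {F : E → 𝔸} {D : E →L[ℝ] 𝔸} {e : E}
    (hF : HasStrictFDerivAt F D e) (a : 𝔸) :
    HasStrictFDerivAt (fun e' => a * F e') ((ContinuousLinearMap.mul ℝ 𝔸 a).comp D) e :=
  (ContinuousLinearMap.mul ℝ 𝔸 a).hasStrictFDerivAt.comp e hF

lemma exists_hasStrictFDerivAt_exp_smul_mul [CompleteSpace 𝔸] {F : E → 𝔸} {D : E →L[ℝ] 𝔸} {e : E}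
    (hF : HasStrictFDerivAt F D e) (a : 𝔸) (t : ℝ) :
    ∃ D' : E × ℝ →L[ℝ] 𝔸,
      HasStrictFDerivAt (fun p : E × ℝ => NormedSpace.exp (p.2 • a) * F p.1) D' (e, t) ∧
        ∀ v c w g, D v = w → F e = g →
          D' (v, c) = NormedSpace.exp (t • a) * (w + c • (a * g)) := by
  have h1 : HasStrictFDerivAt (fun p : E × ℝ => F p.1) (D.comp (.fst ℝ E ℝ)) (e, t) :=
    HasStrictFDerivAt.comp (g := F) (e, t) hF hasStrictFDerivAt_fst
  have h2 := HasStrictFDerivAt.comp (f := Prod.snd) (e, t)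
    (hasStrictFDerivAt_exp_smul_const ℝ a t) (hasStrictFDerivAt_snd (𝕜 := ℝ))
  refine ⟨_, h2.mul' h1, ?_⟩
  rintro v c _ _ rfl rfl
  simp [mul_add, mul_assoc]

end

/-- `W` is a space of directions attained at `Q`: some map into the attainable matrices passes
through `Q` and is strictly differentiable there, and the image of its derivative contains the left
translate `Q W`. -/
def AttainsDirections (𝒳 : Set (Matrix (Fin n) (Fin n) ℂ)) (Q : unitaryGroup (Fin n) ℂ)
    (W : Submodule ℝ (Matrix (Fin n) (Fin n) ℂ)) : Prop :=
  ∃ (E : Type) (_ : NormedAddCommGroup E) (_ : NormedSpace ℝ E) (_ : CompleteSpace E)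
    (F : E → Matrix (Fin n) (Fin n) ℂ) (e : E) (D : E →L[ℝ] Matrix (Fin n) (Fin n) ℂ),
    HasStrictFDerivAt F D e ∧ F e = Q ∧ (∀ᶠ e' in 𝓝 e, ∃ s ∈ attainable 𝒳, F e' = s) ∧
      ∀ w ∈ W, ∃ v, D v = Q * w

variable {𝒳 : Set (Matrix (Fin n) (Fin n) ℂ)} {Q : unitaryGroup (Fin n) ℂ}
  {W : Submodule ℝ (Matrix (Fin n) (Fin n) ℂ)}

lemma attainsDirections_one_bot : AttainsDirections 𝒳 1 ⊥ :=
  ⟨ℝ, inferInstance, inferInstance, inferInstance, fun _ => 1, 0, 0, hasStrictFDerivAt_const _ _,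
    rfl, Eventually.of_forall fun _ => ⟨1, one_mem _, rfl⟩, fun w hw => ⟨0, by
      rw [Submodule.mem_bot] at hw; simp [hw]⟩⟩

lemma AttainsDirections.mem (h : AttainsDirections 𝒳 Q W) : Q ∈ attainable 𝒳 := by
  obtain ⟨E, _, _, _, F, e, D, -, hFe, hS, -⟩ := h
  obtain ⟨s, hs, hFs⟩ := hS.self_of_nhds
  rwa [Subtype.ext (hFe.symm.trans hFs)]

lemma AttainsDirections.mul_left (h : AttainsDirections 𝒳 Q W) {P : unitaryGroup (Fin n) ℂ}
    (hP : P ∈ attainable 𝒳) : AttainsDirections 𝒳 (P * Q) W := by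
  obtain ⟨E, _, _, _, F, e, D, hF, hFe, hS, hD⟩ := h
  refine ⟨E, inferInstance, inferInstance, inferInstance, fun e' => P * F e', e, _,
    hasStrictFDerivAt_mul_left hF (P : Matrix (Fin n) (Fin n) ℂ), by simp [hFe], ?_, ?_⟩
  · filter_upwards [hS] with e' ⟨s, hs, hFs⟩
    exact ⟨P * s, mul_mem hP hs, by simp [hFs]⟩
  · intro w hw
    obtain ⟨v, hv⟩ := hD w hw
    refine ⟨v, (congrArg (fun M => (P : Matrix (Fin n) (Fin n) ℂ) * M) hv).trans ?_⟩
    rw [Submonoid.coe_mul, mul_assoc]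

/-- Prolonging a motion by the flow of `X` adds the direction `Q⁻¹ X Q`. -/
lemma AttainsDirections.flow (h : AttainsDirections 𝒳 Q W) {X : Matrix (Fin n) (Fin n) ℂ}
    (hX𝒳 : X ∈ 𝒳) (hX : X.conjTranspose = -X) :
    AttainsDirections 𝒳 (flow hX 1 * Q)
      (W ⊔ Submodule.span ℝ {((Q⁻¹ : unitaryGroup (Fin n) ℂ) : Matrix (Fin n) (Fin n) ℂ) * X * Q})
    := by
  obtain ⟨E, _, _, _, F, e, D, hF, hFe, hS, hD⟩ := h
  obtain ⟨D', hD', hD'v⟩ := exists_hasStrictFDerivAt_exp_smul_mul hF X 1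
  refine ⟨E × ℝ, inferInstance, inferInstance, inferInstance, _, (e, 1), D', hD', ?_, ?_, ?_⟩
  · rw [hFe]; rfl
  · have ht : ∀ᶠ p : E × ℝ in 𝓝 (e, 1), 0 < p.2 :=
      continuous_snd.continuousAt.eventually (lt_mem_nhds (by simp))
    filter_upwards [continuous_fst.continuousAt.eventually hS, ht] with p ⟨s, hs, hFs⟩ hp
    exact ⟨BilinearControl.flow hX p.2 * s, mul_mem (flow_mem hX𝒳 hX hp) hs, by rw [hFs]; rfl⟩
  · intro w hw
    obtain ⟨w₀, hw₀, w₁, hw₁, rfl⟩ := Submodule.mem_sup.1 hw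
    obtain ⟨c, rfl⟩ := Submodule.mem_span_singleton.1 hw₁
    obtain ⟨v, hv⟩ := hD w₀ hw₀
    have hQ : (Q : Matrix (Fin n) (Fin n) ℂ) *
        (((Q⁻¹ : unitaryGroup (Fin n) ℂ) : Matrix (Fin n) (Fin n) ℂ) * X * Q) = X * Q := by
      rw [← mul_assoc, ← mul_assoc, coe_mul_coe_inv, one_mul]
    refine ⟨(v, c), (hD'v v c _ _ hv hFe).trans ?_⟩
    rw [Submonoid.coe_mul, mul_assoc _ (Q : Matrix (Fin n) (Fin n) ℂ),
      mul_add (Q : Matrix (Fin n) (Fin n) ℂ), mul_smul_comm c (Q : Matrix (Fin n) (Fin n) ℂ), hQ]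
    rfl

/-- At a suitable attainable matrix, the attained directions contain the whole Lie algebra generated
by `𝒳`: a maximal space of attained directions cannot grow by prolonging the motion, so it contains
all the conjugates of the elements of `𝒳`, first by attainable matrices, then by their limits. -/
lemma exists_attainsDirections_lieSpan (h𝒳 : ∀ X ∈ 𝒳, X.conjTranspose = -X) :
    ∃ (Q : unitaryGroup (Fin n) ℂ) (W : Submodule ℝ (Matrix (Fin n) (Fin n) ℂ)),
      AttainsDirections 𝒳 Q W ∧ ∀ Y ∈ LieSubalgebra.lieSpan ℝ _ 𝒳, Y ∈ W := by
  obtain ⟨W, ⟨Q, hQW⟩, hmax⟩ := (wellFounded_gt :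
    WellFounded ((· > ·) : Submodule ℝ (Matrix (Fin n) (Fin n) ℂ) → _ → Prop)).has_min
      {W | ∃ Q, AttainsDirections 𝒳 Q W} ⟨⊥, 1, attainsDirections_one_bot⟩
  have hPQ : ∀ P ∈ attainable 𝒳, ∀ X ∈ 𝒳,
      (((P * Q)⁻¹ : unitaryGroup (Fin n) ℂ) : Matrix (Fin n) (Fin n) ℂ) * X *
        (P * Q : unitaryGroup (Fin n) ℂ) ∈ W := by
    intro P hP X hX
    have h := hmax _ ⟨_, (hQW.mul_left hP).flow hX (h𝒳 X hX)⟩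
    have h' := not_lt_iff_le_imp_ge.1 h le_sup_left
    exact h' (Submodule.mem_sup_right (Submodule.mem_span_singleton_self _))
  refine ⟨Q, W, hQW, fun Y hY => lieSpan_le_of_conj h𝒳 (fun k hk X hX => ?_) hY⟩
  have hclosed : IsClosed {P : unitaryGroup (Fin n) ℂ |
      (((P * Q)⁻¹ : unitaryGroup (Fin n) ℂ) : Matrix (Fin n) (Fin n) ℂ) * X *
        (P * Q : unitaryGroup (Fin n) ℂ) ∈ W} :=
    (W.closed_of_finiteDimensional).preimage (by fun_prop)
  have hmem : k * Q⁻¹ ∈ closure (attainable 𝒳 : Set (unitaryGroup (Fin n) ℂ)) := by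
    rw [← coe_flowGroup]
    exact mul_mem hk (inv_mem (attainable_le_flowGroup hQW.mem))
  have : (((k * Q⁻¹ * Q)⁻¹ : unitaryGroup (Fin n) ℂ) : Matrix (Fin n) (Fin n) ℂ) * X *
      (k * Q⁻¹ * Q : unitaryGroup (Fin n) ℂ) ∈ W :=
    closure_minimal (fun P hP => hPQ P hP X hX) hclosed hmem
  rwa [inv_mul_cancel_right] at this

/-! ### Transitivity on the sphere -/

/-- The Lie algebra generated by `𝒳` maps every unit vector onto the tangent space of the sphere. -/
def IsInfinitesimallyTransitive (𝒳 : Set (Matrix (Fin n) (Fin n) ℂ)) : Prop :=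
  ∀ x v : EuclideanSpace ℂ (Fin n), ‖x‖ = 1 → (inner ℂ x v).re = 0 →
    ∃ Y ∈ LieSubalgebra.lieSpan ℝ (Matrix (Fin n) (Fin n) ℂ) 𝒳, toEuclideanLin Y x = v

lemma exists_hasStrictFDerivAt_smul_clm {𝔸 E H : Type*} [NormedAddCommGroup 𝔸] [NormedSpace ℝ 𝔸]
    [NormedAddCommGroup E] [NormedSpace ℝ E] [NormedAddCommGroup H] [NormedSpace ℝ H] {F : E → 𝔸}
    {D : E →L[ℝ] 𝔸} {e : E} (hF : HasStrictFDerivAt F D e) (ℓ : 𝔸 →L[ℝ] H) (r : ℝ) :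
    ∃ D' : E × ℝ →L[ℝ] H, HasStrictFDerivAt (fun p : E × ℝ => p.2 • ℓ (F p.1)) D' (e, r) ∧
      ∀ v c w g, D v = w → F e = g → D' (v, c) = r • ℓ w + c • ℓ g := by
  have h1 : HasStrictFDerivAt (fun p : E × ℝ => F p.1) (D.comp (.fst ℝ E ℝ)) (e, r) :=
    HasStrictFDerivAt.comp (g := F) (e, r) hF hasStrictFDerivAt_fst
  refine ⟨_, (hasStrictFDerivAt_snd (𝕜 := ℝ)).smul (ℓ.hasStrictFDerivAt.comp (e, r) h1), ?_⟩
  rintro v c _ _ rfl rfl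
  simp

/-- The points attained from a unit vector contain an open piece of the sphere. The radial parameter
`r` turns the motion on the sphere into a submersion onto the whole space. -/
lemma exists_attainable_mem_nhdsWithin (h𝒳 : ∀ X ∈ 𝒳, X.conjTranspose = -X)
    (hT : IsInfinitesimallyTransitive 𝒳) {x : EuclideanSpace ℂ (Fin n)} (hx : ‖x‖ = 1) :
    ∃ Q ∈ attainable 𝒳, {y | ∃ s ∈ attainable 𝒳, evalAt x (s : Matrix (Fin n) (Fin n) ℂ) = y} ∈
      𝓝[Metric.sphere 0 1] (evalAt x (Q : Matrix (Fin n) (Fin n) ℂ)) := by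
  obtain ⟨Q, W, hQW, hLW⟩ := exists_attainsDirections_lieSpan h𝒳
  refine ⟨Q, hQW.mem, ?_⟩
  obtain ⟨E, _, _, _, F, e, D, hF, hFe, hS, hD⟩ := hQW
  obtain ⟨D', hD', hD'v⟩ := exists_hasStrictFDerivAt_smul_clm hF (evalAt x) 1
  have hsurj : D'.range = ⊤ := by
    rw [LinearMap.range_eq_top]
    intro z
    set z' := evalAt z ((Q⁻¹ : unitaryGroup (Fin n) ℂ) : Matrix (Fin n) (Fin n) ℂ) with hz'
    have hz : evalAt z' (Q : Matrix (Fin n) (Fin n) ℂ) = z := by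
      rw [hz', ← evalAt_mul, coe_mul_coe_inv, evalAt_one]
    -- decompose `z' = Q⁻¹ z` into a radial and a tangential part
    set ρ := (inner ℂ x z').re with hρ
    obtain ⟨Y, hY, hYx⟩ := hT x (z' - ρ • x) hx (by
      rw [inner_sub_right, RCLike.real_smul_eq_coe_smul (K := ℂ), inner_smul_right,
        inner_self_eq_norm_sq_to_K, hx]
      simp [hρ])
    obtain ⟨v, hv⟩ := hD Y (hLW Y hY)
    refine ⟨(v, ρ), (hD'v v ρ _ _ hv hFe).trans ?_⟩
    change (1 : ℝ) • evalAt x ((Q : Matrix (Fin n) (Fin n) ℂ) * Y) +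
      ρ • evalAt x (Q : Matrix (Fin n) (Fin n) ℂ) = z
    rw [evalAt_mul, evalAt_apply x Y, hYx, one_smul, ← evalAt_vec_smul, ← evalAt_vec_add,
      sub_add_cancel, hz]
  have hmap := hD'.map_nhds_eq_of_surj hsurj
  simp only [one_smul, hFe] at hmap
  have hpos : ∀ᶠ p : E × ℝ in 𝓝 (e, 1), 0 < p.2 :=
    continuous_snd.continuousAt.eventually (lt_mem_nhds (by simp))
  have hev : ∀ᶠ p : E × ℝ in 𝓝 (e, 1), (∃ s ∈ attainable 𝒳, F p.1 = s) ∧ 0 < p.2 := by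
    filter_upwards [continuous_fst.continuousAt.eventually hS, hpos] with p h h' using ⟨h, h'⟩
  have himg : (fun p : E × ℝ => p.2 • evalAt x (F p.1)) ''
      {p | (∃ s ∈ attainable 𝒳, F p.1 = s) ∧ 0 < p.2} ∈
        𝓝 (evalAt x (Q : Matrix (Fin n) (Fin n) ℂ)) := hmap.ge (image_mem_map hev)
  rw [mem_nhdsWithin_iff_exists_mem_nhds_inter]
  refine ⟨_, himg, ?_⟩
  rintro y ⟨⟨⟨e', r⟩, ⟨⟨s, hs, hFs⟩, hr⟩, rfl⟩, hy⟩
  refine ⟨s, hs, ?_⟩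
  simp only [hFs] at hr hy ⊢
  rw [mem_sphere_zero_iff_norm, norm_smul, norm_evalAt, hx, mul_one,
    Real.norm_of_nonneg hr.le] at hy
  rw [hy, one_smul]

/-- The flow group is transitive on the sphere: its orbits are compact and relatively open, and the
sphere is connected. -/
lemma exists_flowGroup_evalAt_eq (h𝒳 : ∀ X ∈ 𝒳, X.conjTranspose = -X)
    (hT : IsInfinitesimallyTransitive 𝒳) {x y : EuclideanSpace ℂ (Fin n)} (hx : ‖x‖ = 1)
    (hy : ‖y‖ = 1) : ∃ k ∈ flowGroup 𝒳, evalAt x (k : Matrix (Fin n) (Fin n) ℂ) = y := by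
  let O : Set (EuclideanSpace ℂ (Fin n)) :=
    (fun k : unitaryGroup (Fin n) ℂ => evalAt x (k : Matrix (Fin n) (Fin n) ℂ)) '' flowGroup 𝒳
  have hclosed : IsClosed O := by
    have hK : IsClosed (flowGroup 𝒳 : Set (unitaryGroup (Fin n) ℂ)) :=
      Subgroup.isClosed_topologicalClosure _
    exact (hK.isCompact.image ((evalAt x).continuous.comp continuous_subtype_val)).isClosed
  have hnhds : ∀ z ∈ O, O ∈ 𝓝[Metric.sphere 0 1] z := by
    rintro _ ⟨k, hk, rfl⟩
    obtain ⟨Q, hQ, hQx⟩ := exists_attainable_mem_nhdsWithin h𝒳 hT hx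
    set g := Q * k⁻¹ with hg
    have hgK : g ∈ flowGroup 𝒳 := mul_mem (attainable_le_flowGroup hQ) (inv_mem hk)
    -- the unitary map `g` carries the given point `k x` of the orbit to `Q x`
    have hgk : evalAt (evalAt x (k : Matrix (Fin n) (Fin n) ℂ)) (g : Matrix (Fin n) (Fin n) ℂ) =
        evalAt x (Q : Matrix (Fin n) (Fin n) ℂ) := by
      rw [← evalAt_mul, ← Submonoid.coe_mul, hg, inv_mul_cancel_right]
    have hcont : Continuous fun z => evalAt z (g : Matrix (Fin n) (Fin n) ℂ) :=
      (toEuclideanLin (g : Matrix (Fin n) (Fin n) ℂ)).continuous_of_finiteDimensional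
    have htend : Tendsto (fun z => evalAt z (g : Matrix (Fin n) (Fin n) ℂ))
        (𝓝[Metric.sphere 0 1] (evalAt x (k : Matrix (Fin n) (Fin n) ℂ)))
        (𝓝[Metric.sphere 0 1] (evalAt x (Q : Matrix (Fin n) (Fin n) ℂ))) := by
      rw [← hgk]
      refine hcont.continuousWithinAt.tendsto_nhdsWithin fun z hz => ?_
      rw [mem_sphere_zero_iff_norm] at hz ⊢
      rw [norm_evalAt, hz]
    filter_upwards [htend hQx] with z ⟨s, hs, hsz⟩
    refine ⟨g⁻¹ * s, mul_mem (inv_mem hgK) (attainable_le_flowGroup hs), ?_⟩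
    simp only [Submonoid.coe_mul]
    rw [evalAt_mul, hsz, ← evalAt_mul, ← Submonoid.coe_mul, inv_mul_cancel, Submonoid.coe_one,
      evalAt_one]
  have hxO : x ∈ O := ⟨1, one_mem _, evalAt_one x⟩
  have hrank : 1 < Module.rank ℝ (EuclideanSpace ℂ (Fin n)) := by
    have hn : n ≠ 0 := by
      rintro rfl
      rw [Subsingleton.elim x 0, norm_zero] at hx
      exact zero_ne_one hx
    have h := finrank_real_of_complex (EuclideanSpace ℂ (Fin n))
    rw [finrank_euclideanSpace_fin] at h
    rw [← Module.finrank_eq_rank, h]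
    exact_mod_cast (by omega : 1 < 2 * n)
  have : PreconnectedSpace (Metric.sphere (0 : EuclideanSpace ℂ (Fin n)) 1) :=
    Subtype.preconnectedSpace (isPreconnected_sphere hrank 0 1)
  have hclopen : IsClopen ((↑) ⁻¹' O : Set (Metric.sphere (0 : EuclideanSpace ℂ (Fin n)) 1)) :=
    ⟨hclosed.preimage continuous_subtype_val, isOpen_iff_mem_nhds.2 fun z hz =>
      preimage_coe_mem_nhds_subtype.2 (hnhds _ hz)⟩
  have huniv := hclopen.eq_univ ⟨⟨x, by simpa using hx⟩, hxO⟩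
  have : (⟨y, by simpa using hy⟩ : Metric.sphere (0 : EuclideanSpace ℂ (Fin n)) 1) ∈
    ((↑) ⁻¹' O : Set (Metric.sphere (0 : EuclideanSpace ℂ (Fin n)) 1)) := huniv ▸ Set.mem_univ _
  exact this

/-- Exact attainability: the flow group moves `y` into an open piece of the sphere attained from
`x`, and since that group is the closure of the attainable matrices, the inverse of an attainable
matrix does so too. -/
lemma exists_attainable_evalAt_eq (h𝒳 : ∀ X ∈ 𝒳, X.conjTranspose = -X)
    (hT : IsInfinitesimallyTransitive 𝒳) {x y : EuclideanSpace ℂ (Fin n)} (hx : ‖x‖ = 1)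
    (hy : ‖y‖ = 1) : ∃ s ∈ attainable 𝒳, evalAt x (s : Matrix (Fin n) (Fin n) ℂ) = y := by
  obtain ⟨Q, -, hQx⟩ := exists_attainable_mem_nhdsWithin h𝒳 hT hx
  obtain ⟨k, hk, hky⟩ := exists_flowGroup_evalAt_eq h𝒳 hT hy
    (y := evalAt x (Q : Matrix (Fin n) (Fin n) ℂ)) (by rw [norm_evalAt, hx])
  have hcont : Continuous fun s : unitaryGroup (Fin n) ℂ =>
      evalAt y ((s⁻¹ : unitaryGroup (Fin n) ℂ) : Matrix (Fin n) (Fin n) ℂ) :=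
    (evalAt y).continuous.comp (continuous_subtype_val.comp continuous_inv)
  have htend : Tendsto (fun s : unitaryGroup (Fin n) ℂ =>
      evalAt y ((s⁻¹ : unitaryGroup (Fin n) ℂ) : Matrix (Fin n) (Fin n) ℂ)) (𝓝 k⁻¹)
      (𝓝[Metric.sphere 0 1] (evalAt x (Q : Matrix (Fin n) (Fin n) ℂ))) := by
    refine tendsto_nhdsWithin_iff.2 ⟨?_, Eventually.of_forall fun s => ?_⟩
    · rw [← hky]
      simpa only [inv_inv] using hcont.tendsto k⁻¹
    · rw [mem_sphere_zero_iff_norm, norm_evalAt, hy]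
  have hk' : k⁻¹ ∈ closure (attainable 𝒳 : Set (unitaryGroup (Fin n) ℂ)) := by
    rw [← coe_flowGroup]
    exact inv_mem hk
  obtain ⟨s, ⟨s', hs', hss'⟩, hs⟩ := mem_closure_iff_nhds.1 hk' _ (htend hQx)
  refine ⟨s * s', mul_mem hs hs', ?_⟩
  rw [Submonoid.coe_mul, evalAt_mul, hss', ← evalAt_mul, coe_mul_coe_inv, evalAt_one]

/-! ### Controllability -/

lemma endpoint_append (A B : Matrix (Fin n) (Fin n) ℂ) (c d : List (ℝ × ℝ))
    (x : EuclideanSpace ℂ (Fin n)) :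
    endpoint A B (c ++ d) x = endpoint A B d (endpoint A B c x) := List.foldl_append

lemma exists_endpoint_eq_of_mem_attainable {A B : Matrix (Fin n) (Fin n) ℂ} {U : Set ℝ}
    {s : unitaryGroup (Fin n) ℂ} (hs : s ∈ attainable ((fun u : ℝ => u • A + B) '' U)) :
    ∃ c : List (ℝ × ℝ), (∀ p ∈ c, 0 < p.1 ∧ p.2 ∈ U) ∧
      ∀ x, endpoint A B c x = evalAt x (s : Matrix (Fin n) (Fin n) ℂ) := by
  induction hs using Submonoid.closure_induction with
  | mem s hs =>
    obtain ⟨t, ht, _, ⟨u, hu, rfl⟩, h⟩ := hs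
    exact ⟨[(t, u)], by simpa using ⟨ht, hu⟩, fun x => by rw [h]; rfl⟩
  | one => exact ⟨[], by simp, fun x => (evalAt_one x).symm⟩
  | mul s s' _ _ ih ih' =>
    obtain ⟨c, hc, hcs⟩ := ih
    obtain ⟨c', hc', hcs'⟩ := ih'
    refine ⟨c' ++ c, fun p hp => ?_, fun x => ?_⟩
    · rcases List.mem_append.1 hp with h | h
      exacts [hc' p h, hc p h]
    · rw [endpoint_append, hcs, hcs', Submonoid.coe_mul, evalAt_mul]

/-- Infinitesimal transitivity of the admissible vector fields implies controllability. -/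
theorem isControllable_of_isInfinitesimallyTransitive {A B : Matrix (Fin n) (Fin n) ℂ}
    (hA : A.conjTranspose = -A) (hB : B.conjTranspose = -B) {U : Set ℝ} (hU : U.Nonempty)
    (hT : IsInfinitesimallyTransitive ((fun u : ℝ => u • A + B) '' U)) :
    IsControllable A B U := by
  have hskew : ∀ u : ℝ, (u • A + B).conjTranspose = -(u • A + B) := fun u => by
    rw [conjTranspose_add, conjTranspose_smul, hA, hB, star_trivial, smul_neg, neg_add]
  intro x₀ hx₀ x₁ hx₁
  rw [mem_sphere_zero_iff_norm] at hx₀ hx₁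
  obtain ⟨u, hu⟩ := hU
  -- an initial motion of duration one makes the control nonempty
  have hx₀' : ‖evalAt x₀ (flow (hskew u) 1 : Matrix (Fin n) (Fin n) ℂ)‖ = 1 := by
    rw [norm_evalAt, hx₀]
  obtain ⟨s, hs, hsx⟩ := exists_attainable_evalAt_eq
    (by rintro _ ⟨u, -, rfl⟩; exact hskew u) hT hx₀' hx₁
  obtain ⟨c, hc, hcs⟩ := exists_endpoint_eq_of_mem_attainable hs
  refine ⟨(1, u) :: c, List.cons_ne_nil _ _, fun p hp => ?_, ?_⟩
  · rcases List.mem_cons.1 hp with rfl | h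
    exacts [⟨one_pos, hu⟩, hc p h]
  · rw [← hsx, ← hcs]; rfl

lemma mem_lieSpan_of_nontrivial (A B : Matrix (Fin n) (Fin n) ℂ) {U : Set ℝ} (hU : U.Nontrivial) :
    A ∈ LieSubalgebra.lieSpan ℝ (Matrix (Fin n) (Fin n) ℂ) ((fun u : ℝ => u • A + B) '' U) ∧
      B ∈ LieSubalgebra.lieSpan ℝ (Matrix (Fin n) (Fin n) ℂ) ((fun u : ℝ => u • A + B) '' U) := by
  obtain ⟨u, hu, w, hw, huw⟩ := hU
  set L := LieSubalgebra.lieSpan ℝ (Matrix (Fin n) (Fin n) ℂ) ((fun u : ℝ => u • A + B) '' U)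
  have h1 : u • A + B ∈ L := LieSubalgebra.subset_lieSpan ⟨u, hu, rfl⟩
  have h2 : w • A + B ∈ L := LieSubalgebra.subset_lieSpan ⟨w, hw, rfl⟩
  have hAL : A ∈ L := by
    have h := L.smul_mem (u - w)⁻¹ (L.sub_mem h1 h2)
    rwa [add_sub_add_right_eq_sub, ← sub_smul, smul_smul, inv_mul_cancel₀ (sub_ne_zero.2 huw),
      one_smul] at h
  refine ⟨hAL, ?_⟩
  have h := L.sub_mem h1 (L.smul_mem u hAL)
  rwa [add_sub_cancel_left] at h

lemma isInfinitesimallyTransitive_of_isConnected {A B : Matrix (Fin n) (Fin n) ℂ}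
    (hA : A.conjTranspose = -A) (hB : B.conjTranspose = -B) (hAdiag : A.IsDiag)
    (hBconn : IsConnected B)
    (hgap : ∀ j k l m : Fin n, j ≠ k → s(j, k) ≠ s(l, m) →
      ‖A j j - A k k‖ ≠ ‖A l l - A m m‖) {U : Set ℝ} (hU : U.Nontrivial) :
    IsInfinitesimallyTransitive ((fun u : ℝ => u • A + B) '' U) := by
  intro x v hx hv
  obtain ⟨hAL, hBL⟩ := mem_lieSpan_of_nontrivial A B hU
  obtain ⟨Y, hY, hYx⟩ := exists_mulVec_eq hA hB hAdiag hBconn hgap hAL hBL (x := x.ofLp)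
    (v := v.ofLp) (by
      rw [dotProduct_comm, ← EuclideanSpace.inner_eq_star_dotProduct, inner_self_eq_norm_sq_to_K,
        hx]
      simp) (by rwa [dotProduct_comm, ← EuclideanSpace.inner_eq_star_dotProduct])
  exact ⟨Y, hY, by rw [toLpLin_apply, hYx]⟩

end BilinearControl

theorem mainTheorem4 (n : ℕ) (A B : Matrix (Fin n) (Fin n) ℂ)
    (hA : A.conjTranspose = -A) (hB : B.conjTranspose = -B)
    (hAdiag : A.IsDiag) (hBconn : BilinearControl.IsConnected B)
    (hgap : ∀ j k l m : Fin n, j ≠ k → s(j, k) ≠ s(l, m) →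
      ‖A j j - A k k‖ ≠ ‖A l l - A m m‖) :
    BilinearControl.su n ≤
        LieSubalgebra.lieSpan ℝ (Matrix (Fin n) (Fin n) ℂ) {A, B} ∧
      ∀ U : Set ℝ, U.Nontrivial → BilinearControl.IsControllable A B U :=
  ⟨BilinearControl.su_le hA hB hAdiag hBconn hgap
      (LieSubalgebra.subset_lieSpan (Set.mem_insert _ _))
      (LieSubalgebra.subset_lieSpan (Set.mem_insert_of_mem _ rfl)),
    fun _ hU => BilinearControl.isControllable_of_isInfinitesimallyTransitive hA hB hU.nonempty
      (BilinearControl.isInfinitesimallyTransitive_of_isConnected hA hB hAdiag hBconn hgap hU)⟩
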